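/- **Conventions.** A *polynomial endofunctor* $P$ is represented by a diagram of groupoids $I \xleftarrow{s} E \xrightarrow{p} B \xrightarrow{t} I$, assumed finitary: the homotopy fibres of $p$ are equivalent to finite sets. A *cartesian morphism* $u\colon P'\Rightarrow P$ consists of functors $I'\to I$, $E'\to E$, $B'\to B$ together with specified natural isomorphisms filling the three resulting squares, the middle square (the one formed by $p'$ and $p$) being a homotopy pullback. A *forest* is a diagram of finite sets $A\xleftarrow{s} M\xrightarrow{p} N\xrightarrow{t} A$ with $s$ and $t$ injective such that from every edge $x\in A$ the walk $s(m)\mapsto t(p(m))$ reaches a root (an element of $A\setminus s(M)$) in finitely many steps; a *tree* is a forest with exactly one root. A *$P$-forest* (*$P$-tree*) is a forest (tree) with a cartesian morphism from its diagram to $P$; arrows are isomorphisms of the underlying forests together with invertible 2-cells between the decorations, compatible with the specified isomorphisms. These form groupoids $\mathbf T_P\subset\mathbf F_P$. Composing diagrams with $u$ gives morphisms $\mathbf F_u\colon\mathbf F_{P'}\to\mathbf F_P$ and $\mathbf T_u\colon\mathbf T_{P'}\to\mathbf T_P$. The *Green function* of $\mathscr B_P=\mathbb Q[T\in\pi_0\mathbf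 T_P]$ is the fully faithful inclusion $G_P\colon\mathbf T_P\to\mathbf F_P$, regarded as an object of the homotopy slice $\mathbf{Grpd}_{/\mathbf F_P}$. If all $P$-trees have finite automorphism groups it has a numerical version, the formal series $\sum_{T\in\pi_0\mathbf T_P} T/|\mathrm{Aut}(T)|\in\mathbb Q[[T\in\pi_0\mathbf T_P]]$. **Proposition.** Let $u\colon P'\Rightarrow P$ be a cartesian morphism of finitary polynomial endofunctors over groupoids. Then $$G_{P'} = u^*G_P ,$$ in the following sense: 1. in the homotopy slice $\mathbf{Grpd}_{/\mathbf F_{P'}}$, the object $G_{P'}\colon \mathbf T_{P'}\to\mathbf F_{P'}$ is equivalent to the homotopy pullback of $G_P\colon\mathbf T_P\to\mathbf F_P$ along $\mathbf F_u$; 2. more precisely, the canonical square with sides $\mathbf T_{P'}\to\mathbf F_{P'}$, $\mathbf T_u$, $\mathbf F_u$ and $\mathbf T_P\to\mathbf F_P$ is a homotopy pullback, i.e. the comparison functor $\mathbf T_{P'}\to\mathbf F_{P'}\times_{\mathbf F_P}\mathbf T_P$ is an equivalence; 3. if all $P'$-trees and all $P$-trees have finite automorphism groups, then the identity also holds for the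 formal series: $G_{P'}=u^*G_P$ in $\mathbb Q[[T'\in\pi_0\mathbf T_{P'}]]$. Here monomials are identified with isomorphism classes of forests, and the coefficient of $u^*c$ at a forest $S'$ is $c_{u(S')}\cdot|\mathrm{Aut}(u(S'))|/|\mathrm{Aut}(S')|$, which is the homotopy cardinality of homotopy pullback along $\mathbf F_u$. -/

import Mathlib

open CategoryTheory CategoryTheory.Limits
open scoped CategoryTheory.Limits.CategoricalPullback

universe v u v₁ u₁ v₂ u₂ v₃ u₃ v₄ u₄

noncomputable section

/-! ### Homotopy pullbacks and homotopy slices of groupoids -/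

/-- The homotopy pullback `F ⊡ G` (triples `(x, y, F x ≅ G y)`) of groupoids is a groupoid. -/
instance instGroupoidCategoricalPullback {X : Type u₁} {Y : Type u₂} {S : Type u₃}
    [Groupoid.{v₁} X] [Groupoid.{v₂} Y] [Groupoid.{v₃} S] (F : X ⥤ S) (G : Y ⥤ S) :
    Groupoid (F ⊡ G) where
  inv f := ⟨Groupoid.inv f.fst, Groupoid.inv f.snd, by simp⟩

/-- A square commuting up to a specified isomorphism is a homotopy pullback when the canonical
comparison functor to the standard homotopy pullback is an equivalence. -/
def IsHoPullback {X : Type u₁} {Y : Type u₂} {S : Type u₃} {W : Type u₄}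
    [Groupoid.{v₁} X] [Groupoid.{v₂} Y] [Groupoid.{v₃} S] [Groupoid.{v₄} W]
    {F : X ⥤ S} {G : Y ⥤ S} (sq : CategoricalPullback.CatCommSqOver F G W) : Prop :=
  ((CategoricalPullback.CatCommSqOver.toFunctorToCategoricalPullback F G W).obj sq).IsEquivalence

/-- The homotopy fibre of `p` over `b`: the homotopy pullback of `p` along `b : 1 → B`. -/
abbrev HoFibre {E : Type u₁} {B : Type u₂} [Groupoid.{v₁} E] [Groupoid.{v₂} B]
    (p : E ⥤ B) (b : B) :=
  (Functor.fromPUnit.{0} b) ⊡ p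

/-- The set of isomorphism classes of objects (connected components) of a groupoid. -/
def PiZero (C : Type u) [Groupoid.{v} C] : Type u :=
  Quotient (isIsomorphicSetoid C)

/-- The map induced on isomorphism classes by a morphism of groupoids. -/
def PiZero.map {C : Type u₁} {D : Type u₂} [Groupoid.{v₁} C] [Groupoid.{v₂} D] (F : C ⥤ D) :
    PiZero C → PiZero D :=
  Quotient.map' F.obj fun _ _ ⟨e⟩ => ⟨F.mapIso e⟩

/-- A groupoid equivalent to a finite set: arrows are unique when they exist, and there are
finitely many isomorphism classes. -/
def IsFiniteDiscrete (C : Type u) [Groupoid.{v} C] : Prop :=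
  Quiver.IsThin C ∧ Finite (PiZero C)

/-- Objects of the homotopy slice of groupoids over `S`. -/
structure HoSlice (S : Type u) [Groupoid.{v} S] where
  carrier : Type u₁
  [groupoid : Groupoid.{v₁} carrier]
  map : carrier ⥤ S

attribute [instance] HoSlice.groupoid

/-- Equivalence of objects in the homotopy slice: an equivalence of the total groupoids which
commutes with the maps to `S` up to an invertible 2-cell. -/
def HoSlice.Equivalent {S : Type u} [Groupoid.{v} S]
    (X : HoSlice.{v, u, v₁, u₁} S) (Y : HoSlice.{v, u, v₂, u₂} S) : Prop :=
  ∃ e : X.carrier ≌ Y.carrier, Nonempty (X.map ≅ e.functor ⋙ Y.map)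

/-- The pullback functor `f^*` between homotopy slices (on objects): homotopy pullback
along `f`. -/
def HoSlice.pullback {R : Type u₁} {S : Type u₂} [Groupoid.{v₁} R] [Groupoid.{v₂} S]
    (f : R ⥤ S) (X : HoSlice.{v₂, u₂, v₃, u₃} S) : HoSlice R where
  carrier := f ⊡ X.map
  map := CategoricalPullback.π₁ f X.map

/-! ### Polynomial endofunctors over groupoids and their cartesian morphisms -/

/-- A diagram of groupoids `I ← E → B → I`, representing a polynomial endofunctor. -/
structure PolyEndo where
  I : Type u
  E : Type u
  B : Type u
  [groupoidI : Groupoid.{v} I]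
  [groupoidE : Groupoid.{v} E]
  [groupoidB : Groupoid.{v} B]
  s : E ⥤ I
  p : E ⥤ B
  t : B ⥤ I

attribute [instance] PolyEndo.groupoidI PolyEndo.groupoidE PolyEndo.groupoidB

/-- The polynomial is finitary: the homotopy fibres of `p` are finite discrete. -/
def PolyEndo.IsFinitary (P : PolyEndo.{v, u}) : Prop :=
  ∀ b : P.B, IsFiniteDiscrete (HoFibre P.p b)

/-- A cartesian morphism `Q ⇒ P`: functors between the three groupoids, with specified
isomorphisms filling the three squares, the middle square being a homotopy pullback. -/
structure CartMor (Q : PolyEndo.{v₁, u₁}) (P : PolyEndo.{v₂, u₂}) where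
  fI : Q.I ⥤ P.I
  fE : Q.E ⥤ P.E
  fB : Q.B ⥤ P.B
  left : Q.s ⋙ fI ≅ fE ⋙ P.s
  mid : Q.p ⋙ fB ≅ fE ⋙ P.p
  right : Q.t ⋙ fI ≅ fB ⋙ P.t
  cartesian : IsHoPullback (F := fB) (G := P.p) ⟨Q.p, fE, mid⟩

/-- Vertical pasting of squares of groupoids commuting up to isomorphism. -/
@[simps!]
def pasteSquares {X : Type u₁} {Y : Type u₁} {X' : Type u₂} {Y' : Type u₂}
    {X'' : Type u₃} {Y'' : Type u₃}
    [Groupoid.{v₁} X] [Groupoid.{v₁} Y] [Groupoid.{v₂} X'] [Groupoid.{v₂} Y']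
    [Groupoid.{v₃} X''] [Groupoid.{v₃} Y'']
    {h : X ⥤ Y} {h' : X' ⥤ Y'} {h'' : X'' ⥤ Y''}
    {F : X ⥤ X'} {G : Y ⥤ Y'} {F' : X' ⥤ X''} {G' : Y' ⥤ Y''}
    (a : h ⋙ G ≅ F ⋙ h') (b : h' ⋙ G' ≅ F' ⋙ h'') :
    h ⋙ (G ⋙ G') ≅ (F ⋙ F') ⋙ h'' :=
  NatIso.ofComponents (fun x => G'.mapIso (a.app x) ≪≫ b.app (F.obj x)) (fun {x y} f => by
    have h1 := a.hom.naturality f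
    have h2 := b.hom.naturality (F.map f)
    simp only [Functor.comp_map] at h1 h2
    simp only [Functor.comp_map, Iso.trans_hom, Functor.mapIso_hom, Iso.app_hom, Category.assoc]
    rw [← Functor.map_comp_assoc, h1, Functor.map_comp_assoc, h2])

/-- Elementwise criterion for homotopy pullbacks. -/
theorem isHoPullback_iff {X : Type u₁} {Y : Type u₂} {S : Type u₃} {W : Type u₄}
    [Groupoid.{v₁} X] [Groupoid.{v₂} Y] [Groupoid.{v₃} S] [Groupoid.{v₄} W]
    {F : X ⥤ S} {G : Y ⥤ S} (f : W ⥤ X) (g : W ⥤ Y) (i : f ⋙ F ≅ g ⋙ G) :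
    IsHoPullback (F := F) (G := G) ⟨f, g, i⟩ ↔
      (∀ (x y : W) (k l : x ⟶ y), f.map k = f.map l → g.map k = g.map l → k = l) ∧
      (∀ (x y : W) (k : f.obj x ⟶ f.obj y) (l : g.obj x ⟶ g.obj y),
        F.map k ≫ i.hom.app y = i.hom.app x ≫ G.map l → ∃ m : x ⟶ y, f.map m = k ∧ g.map m = l) ∧
      (∀ (x : X) (y : Y) (e : F.obj x ≅ G.obj y),
        ∃ (w : W) (k : f.obj w ≅ x) (l : g.obj w ≅ y),
          F.map k.hom ≫ e.hom = i.hom.app w ≫ G.map l.hom) := by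
  constructor
  · intro h
    have hf := h.faithful
    have hl := h.full
    have he := h.essSurj
    refine ⟨fun x y k l h1 h2 => hf.map_injective (CategoricalPullback.hom_ext h1 h2),
      fun x y k l w => ?_, fun x y e => ?_⟩
    · obtain ⟨m, hm⟩ := hl.map_surjective (X := x) (Y := y) ⟨k, l, w⟩
      exact ⟨m, congrArg CategoricalPullback.Hom.fst hm, congrArg CategoricalPullback.Hom.snd hm⟩
    · obtain ⟨w, ⟨d⟩⟩ := he.mem_essImage ⟨x, y, e⟩
      exact ⟨w, (CategoricalPullback.π₁ _ _).mapIso d, (CategoricalPullback.π₂ _ _).mapIso d,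
        d.hom.w⟩
  · rintro ⟨h1, h2, h3⟩
    refine { faithful := ⟨?_⟩, full := ⟨?_⟩, essSurj := ⟨?_⟩ }
    · intro x y k l hkl
      exact h1 x y k l (congrArg CategoricalPullback.Hom.fst hkl)
        (congrArg CategoricalPullback.Hom.snd hkl)
    · intro x y φ
      obtain ⟨m, hm1, hm2⟩ := h2 x y φ.fst φ.snd φ.w
      exact ⟨m, CategoricalPullback.hom_ext hm1 hm2⟩
    · intro z
      obtain ⟨w, k, l, hw⟩ := h3 z.fst z.snd z.iso
      exact ⟨w, ⟨CategoricalPullback.mkIso k l hw⟩⟩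

/-- Homotopy pullback squares can be pasted. -/
theorem isHoPullback_paste {X : Type u₁} {Y : Type u₁} {X' : Type u₂} {Y' : Type u₂}
    {X'' : Type u₃} {Y'' : Type u₃}
    [Groupoid.{v₁} X] [Groupoid.{v₁} Y] [Groupoid.{v₂} X'] [Groupoid.{v₂} Y']
    [Groupoid.{v₃} X''] [Groupoid.{v₃} Y'']
    {h : X ⥤ Y} {h' : X' ⥤ Y'} {h'' : X'' ⥤ Y''}
    {F : X ⥤ X'} {G : Y ⥤ Y'} {F' : X' ⥤ X''} {G' : Y' ⥤ Y''}
    (a : h ⋙ G ≅ F ⋙ h') (b : h' ⋙ G' ≅ F' ⋙ h'')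
    (ha : IsHoPullback (F := G) (G := h') ⟨h, F, a⟩)
    (hb : IsHoPullback (F := G') (G := h'') ⟨h', F', b⟩) :
    IsHoPullback (F := G ⋙ G') (G := h'') ⟨h, F ⋙ F', pasteSquares a b⟩ := by
  rw [isHoPullback_iff] at ha hb ⊢
  obtain ⟨fa, la, ea⟩ := ha
  obtain ⟨fb, lb, eb⟩ := hb
  simp only [Functor.comp_obj, Functor.comp_map, pasteSquares_hom_app, Category.assoc] at *
  have na := fun {x y} (f : x ⟶ y) => a.hom.naturality f
  have nb := fun {x y} (f : x ⟶ y) => b.hom.naturality f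
  simp only [Functor.comp_obj, Functor.comp_map] at na nb
  refine ⟨fun x y f g h1 h2 => ?_, fun x y k l w => ?_, fun x y e => ?_⟩
  · refine fa _ _ _ _ h1 (fb _ _ _ _ ?_ h2)
    rw [← cancel_epi (a.hom.app x)]
    exact (na f).symm.trans ((congrArg (fun q => G.map q ≫ a.hom.app y) h1).trans (na g))
  · obtain ⟨q, hq⟩ : ∃ q : h'.obj (F.obj x) ⟶ h'.obj (F.obj y),
        a.hom.app x ≫ q = G.map k ≫ a.hom.app y :=
      ⟨_, IsIso.hom_inv_id_assoc (a.hom.app x) (G.map k ≫ a.hom.app y)⟩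
    obtain ⟨ψ, h1, h2⟩ := lb (F.obj x) (F.obj y) q l (by
      have hq' := congrArg (fun r => G'.map r) hq
      rw [Functor.map_comp, Functor.map_comp] at hq'
      rw [← cancel_epi (G'.map (a.hom.app x)), ← w, ← Category.assoc, hq', Category.assoc])
    obtain ⟨χ, k1, k2⟩ := la x y k ψ (by rw [h1, hq])
    exact ⟨χ, k1, by rw [k2, h2]⟩
  · obtain ⟨x', e1, e2, we⟩ := eb (G.obj x) y e
    obtain ⟨w, d1, d2, wd⟩ := ea x x' e1.symm
    refine ⟨w, d1, F'.mapIso d2 ≪≫ e2, ?_⟩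
    have wd' : G.map d1.hom = a.hom.app w ≫ h'.map d2.hom ≫ e1.hom := by
      rw [← Category.assoc, ← wd]; simp
    simp only [Functor.mapIso_hom, Iso.trans_hom, Functor.map_comp]
    rw [wd']
    simp only [Functor.map_comp, Category.assoc]
    rw [we, reassoc_of% (nb d2.hom)]

/-- Composition of cartesian morphisms: stacking the diagrams. -/
@[simps]
def CartMor.comp {R : PolyEndo.{v₁, u₁}} {Q : PolyEndo.{v₂, u₂}} {P : PolyEndo.{v₃, u₃}}
    (g : CartMor R Q) (f : CartMor Q P) : CartMor R P where
  fI := g.fI ⋙ f.fI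
  fE := g.fE ⋙ f.fE
  fB := g.fB ⋙ f.fB
  left := pasteSquares g.left f.left
  mid := pasteSquares g.mid f.mid
  right := pasteSquares g.right f.right
  cartesian := isHoPullback_paste _ _ g.cartesian f.cartesian

/-! ### Trees and forests -/

/-- A diagram of finite sets `A ← M → N → A`: edges, nodes with a marked input edge, nodes. -/
structure TreeDiagram where
  A : Type
  M : Type
  N : Type
  [finA : Finite A]
  [finM : Finite M]
  [finN : Finite N]
  s : M → A
  p : M → N
  t : N → A

/-- A root is an edge which is not an input edge of any node. -/
def TreeDiagram.IsRoot (S : TreeDiagram) (a : S.A) : Prop := ∀ m, S.s m ≠ a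

open Classical in
/-- The walk-to-the-root function: roots are fixed, and `s m` is sent to `t (p m)`. -/
def TreeDiagram.walk (S : TreeDiagram) (a : S.A) : S.A :=
  if h : ∃ m, S.s m = a then S.t (S.p h.choose) else a

/-- A finite rooted forest: `s` and `t` are injective, and from every edge one reaches a root
in finitely many steps.  (These diagrams are the finite disjoint unions of trees.) -/
structure Forest extends TreeDiagram where
  t_injective : Function.Injective t
  s_injective : Function.Injective s
  walk_root : ∀ a : A, ∃ k : ℕ, toTreeDiagram.IsRoot (toTreeDiagram.walk^[k] a)

/-- A tree is a forest with exactly one root. -/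
def Forest.IsTree (S : Forest) : Prop := ∃! r : S.A, S.IsRoot r

/-- A forest regarded as a polynomial endofunctor (over discrete groupoids). -/
@[simps]
def Forest.poly (S : Forest) : PolyEndo.{0, 0} where
  I := Discrete S.A
  E := Discrete S.M
  B := Discrete S.N
  s := Discrete.functor fun m => ⟨S.s m⟩
  p := Discrete.functor fun m => ⟨S.p m⟩
  t := Discrete.functor fun n => ⟨S.t n⟩

/-- An isomorphism of forests. -/
@[ext]
structure Forest.Iso (S T : Forest) where
  a : S.A ≃ T.A
  m : S.M ≃ T.M
  n : S.N ≃ T.N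
  comm_s : ∀ x, a (S.s x) = T.s (m x)
  comm_p : ∀ x, n (S.p x) = T.p (m x)
  comm_t : ∀ x, a (S.t x) = T.t (n x)

/-! ### The groupoids of `P`-forests and `P`-trees -/

/-- A `P`-forest: a forest decorated by `P`, i.e. with a cartesian morphism to `P`. -/
structure PForest (P : PolyEndo.{v, u}) where
  forest : Forest
  dec : CartMor forest.poly P

namespace PForest

variable {P : PolyEndo.{v, u}}

/-- The decoration of an edge. -/
abbrev edge (X : PForest P) (a : X.forest.A) : P.I := X.dec.fI.obj ⟨a⟩

/-- The decoration of a node with a marked input edge. -/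
abbrev input (X : PForest P) (m : X.forest.M) : P.E := X.dec.fE.obj ⟨m⟩

/-- The decoration of a node. -/
abbrev node (X : PForest P) (n : X.forest.N) : P.B := X.dec.fB.obj ⟨n⟩

/-- The specified isomorphism in the left-hand square. -/
abbrev leftIso (X : PForest P) (m : X.forest.M) :
    X.edge (X.forest.s m) ≅ P.s.obj (X.input m) := X.dec.left.app ⟨m⟩

/-- The specified isomorphism in the middle square. -/
abbrev midIso (X : PForest P) (m : X.forest.M) :
    X.node (X.forest.p m) ≅ P.p.obj (X.input m) := X.dec.mid.app ⟨m⟩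

/-- The specified isomorphism in the right-hand square. -/
abbrev rightIso (X : PForest P) (n : X.forest.N) :
    X.edge (X.forest.t n) ≅ P.t.obj (X.node n) := X.dec.right.app ⟨n⟩

/-- An arrow of `P`-forests: an isomorphism `σ` of the underlying forests together with
(invertible) 2-cells from the decoration of `X` to the decoration of `Y` composed with `σ`,
compatible with the specified isomorphisms in the three squares.  The component at `a` is
written `edge a b h` for `h : σ a = b`, to avoid transports; similarly for the others. -/
@[ext]
structure Hom (X Y : PForest P) where
  σ : X.forest.Iso Y.forest
  edge : ∀ a b, σ.a a = b → (X.edge a ⟶ Y.edge b)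
  input : ∀ a b, σ.m a = b → (X.input a ⟶ Y.input b)
  node : ∀ a b, σ.n a = b → (X.node a ⟶ Y.node b)
  comm_left : ∀ m, edge _ _ (σ.comm_s m) ≫ (Y.leftIso (σ.m m)).hom =
    (X.leftIso m).hom ≫ P.s.map (input m _ rfl)
  comm_mid : ∀ m, node _ _ (σ.comm_p m) ≫ (Y.midIso (σ.m m)).hom =
    (X.midIso m).hom ≫ P.p.map (input m _ rfl)
  comm_right : ∀ n, edge _ _ (σ.comm_t n) ≫ (Y.rightIso (σ.n n)).hom =
    (X.rightIso n).hom ≫ P.t.map (node n _ rfl)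

variable {X Y Z W : PForest P}

/-- The identity arrow. -/
@[simps]
def Hom.id (X : PForest P) : Hom X X where
  σ := ⟨Equiv.refl _, Equiv.refl _, Equiv.refl _, fun _ => rfl, fun _ => rfl, fun _ => rfl⟩
  edge _ _ h := X.dec.fI.map ⟨⟨h⟩⟩
  input _ _ h := X.dec.fE.map ⟨⟨h⟩⟩
  node _ _ h := X.dec.fB.map ⟨⟨h⟩⟩
  comm_left m := (X.dec.left.hom.naturality (𝟙 (⟨m⟩ : Discrete X.forest.M)))
  comm_mid m := (X.dec.mid.hom.naturality (𝟙 (⟨m⟩ : Discrete X.forest.M)))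
  comm_right n := (X.dec.right.hom.naturality (𝟙 (⟨n⟩ : Discrete X.forest.N)))

/-- Composition of arrows. -/
@[simps]
def Hom.comp (f : Hom X Y) (g : Hom Y Z) : Hom X Z where
  σ := ⟨f.σ.a.trans g.σ.a, f.σ.m.trans g.σ.m, f.σ.n.trans g.σ.n,
    fun x => by simp [f.σ.comm_s, g.σ.comm_s], fun x => by simp [f.σ.comm_p, g.σ.comm_p],
    fun x => by simp [f.σ.comm_t, g.σ.comm_t]⟩
  edge a b h := f.edge a _ rfl ≫ g.edge _ b h
  input a b h := f.input a _ rfl ≫ g.input _ b h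
  node a b h := f.node a _ rfl ≫ g.node _ b h
  comm_left m := by
    have key : ∀ (b) (h : f.σ.a (X.forest.s m) = b) (h' : g.σ.a b = Z.forest.s (g.σ.m (f.σ.m m))),
        f.edge _ _ rfl ≫ g.edge _ _ (by rw [h, h']) = f.edge _ b h ≫ g.edge b _ h' := by
      rintro _ rfl _; rfl
    have k := key _ (f.σ.comm_s m) (g.σ.comm_s _)
    have h1 := f.comm_left m
    have h2 := g.comm_left (f.σ.m m)
    refine (congrArg (fun q => q ≫ (Z.leftIso (g.σ.m (f.σ.m m))).hom) k).trans ?_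
    rw [Category.assoc, h2, reassoc_of% h1, Functor.map_comp]
    rfl
  comm_mid m := by
    have key : ∀ (b) (h : f.σ.n (X.forest.p m) = b) (h' : g.σ.n b = Z.forest.p (g.σ.m (f.σ.m m))),
        f.node _ _ rfl ≫ g.node _ _ (by rw [h, h']) = f.node _ b h ≫ g.node b _ h' := by
      rintro _ rfl _; rfl
    have k := key _ (f.σ.comm_p m) (g.σ.comm_p _)
    have h1 := f.comm_mid m
    have h2 := g.comm_mid (f.σ.m m)
    refine (congrArg (fun q => q ≫ (Z.midIso (g.σ.m (f.σ.m m))).hom) k).trans ?_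
    rw [Category.assoc, h2, reassoc_of% h1, Functor.map_comp]
    rfl
  comm_right n := by
    have key : ∀ (b) (h : f.σ.a (X.forest.t n) = b) (h' : g.σ.a b = Z.forest.t (g.σ.n (f.σ.n n))),
        f.edge _ _ rfl ≫ g.edge _ _ (by rw [h, h']) = f.edge _ b h ≫ g.edge b _ h' := by
      rintro _ rfl _; rfl
    have k := key _ (f.σ.comm_t n) (g.σ.comm_t _)
    have h1 := f.comm_right n
    have h2 := g.comm_right (f.σ.n n)
    refine (congrArg (fun q => q ≫ (Z.rightIso (g.σ.n (f.σ.n n))).hom) k).trans ?_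
    rw [Category.assoc, h2, reassoc_of% h1, Functor.map_comp]
    rfl

theorem Hom.ext' {f g : Hom X Y} (hσ : f.σ = g.σ)
    (h1 : ∀ a b h h', f.edge a b h = g.edge a b h')
    (h2 : ∀ a b h h', f.input a b h = g.input a b h')
    (h3 : ∀ a b h h', f.node a b h = g.node a b h') : f = g := by
  cases f; cases g
  cases hσ
  congr
  · funext a b h; exact h1 a b h h
  · funext a b h; exact h2 a b h h
  · funext a b h; exact h3 a b h h

/-- The inverse arrow. -/
@[simps]
def Hom.symm (f : Hom X Y) : Hom Y X where
  σ := ⟨f.σ.a.symm, f.σ.m.symm, f.σ.n.symm,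
    fun x => by rw [Equiv.symm_apply_eq, f.σ.comm_s, Equiv.apply_symm_apply],
    fun x => by rw [Equiv.symm_apply_eq, f.σ.comm_p, Equiv.apply_symm_apply],
    fun x => by rw [Equiv.symm_apply_eq, f.σ.comm_t, Equiv.apply_symm_apply]⟩
  edge a b h := Groupoid.inv (f.edge b a (by rw [← h, Equiv.apply_symm_apply]))
  input a b h := Groupoid.inv (f.input b a (by rw [← h, Equiv.apply_symm_apply]))
  node a b h := Groupoid.inv (f.node b a (by rw [← h, Equiv.apply_symm_apply]))
  comm_left m := by
    obtain ⟨m, rfl⟩ := f.σ.m.surjective m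
    have key : ∀ (b) (h : f.σ.m.symm (f.σ.m m) = b) (h' : f.σ.m b = f.σ.m m)
        (h'' : f.σ.a (X.forest.s b) = Y.forest.s (f.σ.m m)),
        Groupoid.inv (f.edge (X.forest.s b) _ h'') ≫ (X.leftIso b).hom =
          (Y.leftIso (f.σ.m m)).hom ≫ P.s.map (Groupoid.inv (f.input b _ h')) := by
      intro b h h' h''
      rw [Equiv.symm_apply_apply] at h
      subst h
      have w := f.comm_left m
      rw [Groupoid.inv_eq_inv, Groupoid.inv_eq_inv, Functor.map_inv, IsIso.inv_comp_eq,
        ← Category.assoc, IsIso.eq_comp_inv, w]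
    exact key _ rfl _ _
  comm_mid m := by
    obtain ⟨m, rfl⟩ := f.σ.m.surjective m
    have key : ∀ (b) (h : f.σ.m.symm (f.σ.m m) = b) (h' : f.σ.m b = f.σ.m m)
        (h'' : f.σ.n (X.forest.p b) = Y.forest.p (f.σ.m m)),
        Groupoid.inv (f.node (X.forest.p b) _ h'') ≫ (X.midIso b).hom =
          (Y.midIso (f.σ.m m)).hom ≫ P.p.map (Groupoid.inv (f.input b _ h')) := by
      intro b h h' h''
      rw [Equiv.symm_apply_apply] at h
      subst h
      have w := f.comm_mid m
      rw [Groupoid.inv_eq_inv, Groupoid.inv_eq_inv, Functor.map_inv, IsIso.inv_comp_eq,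
        ← Category.assoc, IsIso.eq_comp_inv, w]
    exact key _ rfl _ _
  comm_right m := by
    obtain ⟨m, rfl⟩ := f.σ.n.surjective m
    have key : ∀ (b) (h : f.σ.n.symm (f.σ.n m) = b) (h' : f.σ.n b = f.σ.n m)
        (h'' : f.σ.a (X.forest.t b) = Y.forest.t (f.σ.n m)),
        Groupoid.inv (f.edge (X.forest.t b) _ h'') ≫ (X.rightIso b).hom =
          (Y.rightIso (f.σ.n m)).hom ≫ P.t.map (Groupoid.inv (f.node b _ h')) := by
      intro b h h' h''
      rw [Equiv.symm_apply_apply] at h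
      subst h
      have w := f.comm_right m
      rw [Groupoid.inv_eq_inv, Groupoid.inv_eq_inv, Functor.map_inv, IsIso.inv_comp_eq,
        ← Category.assoc, IsIso.eq_comp_inv, w]
    exact key _ rfl _ _

/-- The groupoid of `P`-forests. -/
instance instGroupoid (P : PolyEndo.{v, u}) : Groupoid (PForest P) where
  Hom := Hom
  id := Hom.id
  comp := Hom.comp
  inv := Hom.symm
  id_comp f := by
    refine Hom.ext' rfl ?_ ?_ ?_ <;> intro a b h _ <;> cases h
    · exact (congrArg (· ≫ _) (CategoryTheory.Functor.map_id _ _)).trans (Category.id_comp _)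
    · exact (congrArg (· ≫ _) (CategoryTheory.Functor.map_id _ _)).trans (Category.id_comp _)
    · exact (congrArg (· ≫ _) (CategoryTheory.Functor.map_id _ _)).trans (Category.id_comp _)
  comp_id f := by
    refine Hom.ext' rfl ?_ ?_ ?_ <;> intro a b h _ <;> cases h
    · exact (congrArg (_ ≫ ·) (CategoryTheory.Functor.map_id _ _)).trans (Category.comp_id _)
    · exact (congrArg (_ ≫ ·) (CategoryTheory.Functor.map_id _ _)).trans (Category.comp_id _)
    · exact (congrArg (_ ≫ ·) (CategoryTheory.Functor.map_id _ _)).trans (Category.comp_id _)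
  assoc f g h := by
    refine Hom.ext' rfl ?_ ?_ ?_ <;> intro a b h _ <;> exact Category.assoc _ _ _
  inv_comp {X Y} f := by
    refine Hom.ext' ?_ ?_ ?_ ?_
    · ext x
      · exact f.σ.a.apply_symm_apply x
      · exact f.σ.m.apply_symm_apply x
      · exact f.σ.n.apply_symm_apply x
    · rintro a b h h'
      cases h'
      exact (Groupoid.inv_comp _).trans (CategoryTheory.Functor.map_id _ _).symm
    · rintro a b h h'
      cases h'
      exact (Groupoid.inv_comp _).trans (CategoryTheory.Functor.map_id _ _).symm
    · rintro a b h h'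
      cases h'
      exact (Groupoid.inv_comp _).trans (CategoryTheory.Functor.map_id _ _).symm
  comp_inv {X Y} f := by
    refine Hom.ext' ?_ ?_ ?_ ?_
    · ext x
      · exact f.σ.a.symm_apply_apply x
      · exact f.σ.m.symm_apply_apply x
      · exact f.σ.n.symm_apply_apply x
    · rintro a b h h'
      cases h'
      exact (Groupoid.comp_inv _).trans (CategoryTheory.Functor.map_id _ _).symm
    · rintro a b h h'
      cases h'
      exact (Groupoid.comp_inv _).trans (CategoryTheory.Functor.map_id _ _).symm
    · rintro a b h h'
      cases h'
      exact (Groupoid.comp_inv _).trans (CategoryTheory.Functor.map_id _ _).symm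

end PForest

theorem paste_aux {C : Type u} [Category.{v} C] {a b c d e f : C} {x : a ⟶ b} {y : b ⟶ c}
    {z : c ⟶ d} {x' : a ⟶ e} {y' : e ⟶ c} {w : e ⟶ f} {w' : f ⟶ d}
    (h1 : x ≫ y = x' ≫ y') (h2 : y' ≫ z = w ≫ w') : x ≫ y ≫ z = (x' ≫ w) ≫ w' := by
  rw [← Category.assoc, h1, Category.assoc, h2, Category.assoc]

/-- Redecoration of forests along a cartesian morphism `u : P' ⇒ P`, by composing the decorating
diagram with `u`: the induced morphism from the groupoid of `P'`-forests to that of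
`P`-forests. -/
def forestMap {P' : PolyEndo.{v₁, u₁}} {P : PolyEndo.{v₂, u₂}} (u : CartMor P' P) :
    PForest P' ⥤ PForest P where
  obj X := ⟨X.forest, X.dec.comp u⟩
  map {X Y} f :=
    { σ := f.σ
      edge := fun a b h => u.fI.map (f.edge a b h)
      input := fun a b h => u.fE.map (f.input a b h)
      node := fun a b h => u.fB.map (f.node a b h)
      comm_left := fun m => by
        have h1 := congrArg (fun q => u.fI.map q) (f.comm_left m)
        have h2 := u.left.hom.naturality (f.input m _ rfl)
        simp only [Functor.map_comp, Functor.comp_map] at h1 h2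
        exact paste_aux h1 h2
      comm_mid := fun m => by
        have h1 := congrArg (fun q => u.fB.map q) (f.comm_mid m)
        have h2 := u.mid.hom.naturality (f.input m _ rfl)
        simp only [Functor.map_comp, Functor.comp_map] at h1 h2
        exact paste_aux h1 h2
      comm_right := fun n => by
        have h1 := congrArg (fun q => u.fI.map q) (f.comm_right n)
        have h2 := u.right.hom.naturality (f.node n _ rfl)
        simp only [Functor.map_comp, Functor.comp_map] at h1 h2
        exact paste_aux h1 h2 }
  map_id X := PForest.Hom.ext' rfl (fun _ _ _ _ => rfl) (fun _ _ _ _ => rfl) (fun _ _ _ _ => rfl)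
  map_comp f g := PForest.Hom.ext' rfl (fun _ _ _ _ => u.fI.map_comp _ _)
    (fun _ _ _ _ => u.fE.map_comp _ _) (fun _ _ _ _ => u.fB.map_comp _ _)

/-- A `P`-tree is a `P`-forest whose underlying forest is a tree. -/
def isTreeProp (P : PolyEndo.{v, u}) : ObjectProperty (PForest P) := fun X => X.forest.IsTree

/-- The groupoid of `P`-trees. -/
abbrev PTree (P : PolyEndo.{v, u}) := (isTreeProp P).FullSubcategory

instance instGroupoidPTree (P : PolyEndo.{v, u}) : Groupoid (PTree P) :=
  Groupoid.ofFullyFaithfulToGroupoid (isTreeProp P).ι (isTreeProp P).fullyFaithfulι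

/-- The inclusion of `P`-trees into `P`-forests. -/
abbrev treeIncl (P : PolyEndo.{v, u}) : PTree P ⥤ PForest P := (isTreeProp P).ι

/-- Redecoration of trees along a cartesian morphism. -/
def treeMap {P' : PolyEndo.{v₁, u₁}} {P : PolyEndo.{v₂, u₂}} (u : CartMor P' P) :
    PTree P' ⥤ PTree P :=
  (isTreeProp P).lift (treeIncl P' ⋙ forestMap u) fun X => X.property

/-! ### Green functions -/

/-- The Green function of `P`: the functor from `P`-trees to `P`-forests, as an object of the
homotopy slice of groupoids over the groupoid of `P`-forests. -/
def green (P : PolyEndo.{v, u}) : HoSlice (PForest P) where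
  carrier := PTree P
  map := treeIncl P

/-- The (strictly commutative) square formed by the inclusions of trees into forests and the
redecoration functors. -/
def greenSquare {P' : PolyEndo.{v₁, u₁}} {P : PolyEndo.{v₂, u₂}} (u : CartMor P' P) :
    CategoricalPullback.CatCommSqOver (forestMap u) (treeIncl P) (PTree P') where
  fst := treeIncl P'
  snd := treeMap u
  iso := Iso.refl _

/-- The order of the automorphism group of an object, as a function on isomorphism classes. -/
def PiZero.autCard {C : Type u} [Groupoid.{v} C] : PiZero C → ℕ :=
  Quotient.lift (fun X => Nat.card (Aut X)) fun _ _ ⟨e⟩ =>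
    Nat.card_congr (Aut.autMulEquivOfIso e).toEquiv

/-- The order of the automorphism group of the forest with `m T` components isomorphic to `T`
(a forest being identified, up to isomorphism, with a monomial in the variables `T`). -/
def forestAutCard {C : Type u} [Groupoid.{v} C] (m : PiZero C →₀ ℕ) : ℕ :=
  m.prod fun T k => k.factorial * T.autCard ^ k

open Classical in
/-- The Green function at the level of formal series: `∑ T / |Aut T|` over the isomorphism classes
of `P`-trees, in the completion of the algebra `ℚ[T ∈ π₀ (P-trees)]`. -/
def greenSeries (P : PolyEndo.{v, u}) : MvPowerSeries (PiZero (PTree P)) ℚ := fun m =>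
  ∑ T ∈ m.support, if m = Finsupp.single T 1 then (1 : ℚ) / T.autCard else 0

/-- Pullback of formal series along `u`, i.e. the homotopy cardinality of homotopy pullback along
the map of groupoids of forests.  A family of groupoids `X_S` over the forests `S` has cardinality
`∑ |X_S| / |Aut S| · S` and its pullback has fibre `X_{u S'}` over `S'`, so the coefficient `c_{uS'}`
is multiplied by `|Aut (u S')| / |Aut S'|`. -/
def pullbackSeries {P' : PolyEndo.{v₁, u₁}} {P : PolyEndo.{v₂, u₂}} (u : CartMor P' P)
    (c : MvPowerSeries (PiZero (PTree P)) ℚ) : MvPowerSeries (PiZero (PTree P')) ℚ := fun m =>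
  let n := m.mapDomain (PiZero.map (treeMap u))
  MvPowerSeries.coeff n c * forestAutCard n / forestAutCard m

end

/-! ### Trees are invariant under isomorphism of forests -/

/-! Redecoration along `u` leaves the underlying forest untouched, and being a tree is a property of
the underlying forest alone, invariant under isomorphism (`Forest.Iso.isTree`). Thus `P`-trees form
a full replete subgroupoid of the `P`-forests, and its preimage under `forestMap u` is exactly the
subgroupoid of `P'`-trees. The homotopy pullback of a full replete inclusion is the inclusion of the
preimage, so the square is a homotopy pullback (`isHoPullback_greenSquare`). The equivalence in the
slice is then the comparison functor itself.

For the series, the Green function has nonzero coefficients only at monomials of degree one, and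
substituting `u T` for each variable `T` preserves the degree. Away from degree one both sides
vanish. At the monomial `T` the pullback weight turns `1 / |Aut (u T)|` into `1 / |Aut T|`, a
cancellation that is legitimate because `|Aut (u T)|` is finite and nonzero. -/

/-- Compatibility with `s` makes the bijection on edges match the image of `s` in one forest with
that in the other, hence also the complements. -/
theorem Forest.Iso.isRoot_iff {S T : Forest} (e : S.Iso T) (a : S.A) :
    T.IsRoot (e.a a) ↔ S.IsRoot a := by
  constructor
  · intro h m hm
    exact h (e.m m) (by rw [← e.comm_s, hm])
  · intro h m hm
    refine h (e.m.symm m) (e.a.injective ?_)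
    rw [e.comm_s, Equiv.apply_symm_apply, hm]

theorem Forest.Iso.isTree {S T : Forest} (e : S.Iso T) (h : T.IsTree) : S.IsTree :=
  (e.a.bijective.existsUnique_iff.trans (existsUnique_congr e.isRoot_iff)).mp h

/-! ### The square of groupoids -/

theorem isHoPullback_greenSquare {P' : PolyEndo.{v₁, u₁}} {P : PolyEndo.{v₂, u₂}}
    (u : CartMor P' P) : IsHoPullback (greenSquare u) := by
  refine (isHoPullback_iff (F := forestMap u) (G := treeIncl P) (treeIncl P') (treeMap u)
    (Iso.refl _)).mpr ⟨fun X Y k l h _ => (treeIncl P').map_injective h,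
      fun X Y k l h => ?_, fun X T e => ?_⟩
  -- Fullness: the arrow of `P'`-trees is forced by `k`. The 2-cell of the square is the identity,
  -- so compatibility says that `k` redecorated is `l`, and faithfulness of `treeIncl P` identifies
  -- the second component.
  · refine ⟨(treeIncl P').preimage k, (treeIncl P').map_preimage k,
      (treeIncl P).map_injective ?_⟩
    have h' : (forestMap u).map k ≫ 𝟙 _ = 𝟙 _ ≫ (treeIncl P).map l := h
    rw [Category.comp_id, Category.id_comp] at h'
    rw [← h']
    exact congrArg (forestMap u).map ((treeIncl P').map_preimage k)
  -- Essential surjectivity: the forest isomorphism underlying `e` starts at the forest of `X`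
  -- itself, because redecoration keeps it definitionally. Hence `X` is a tree.
  · have hX : isTreeProp P' X := (show X.forest.Iso T.obj.forest from e.hom.σ).isTree T.property
    -- The preimage is `X` seen as a tree; `e` lifts to an isomorphism of trees by full
    -- faithfulness.
    refine ⟨⟨X, hX⟩, Iso.refl X,
      (treeIncl P).preimageIso (X := (treeMap u).obj ⟨X, hX⟩) e, ?_⟩
    have h : (forestMap u).map (𝟙 X) ≫ e.hom = 𝟙 _ ≫ (treeIncl P).map
        ((treeIncl P).preimageIso (X := (treeMap u).obj ⟨X, hX⟩) e).hom := by
      rw [CategoryTheory.Functor.map_id, Category.id_comp, Category.id_comp]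
      exact ((treeIncl P).map_preimage (X := (treeMap u).obj ⟨X, hX⟩) e.hom).symm
    exact h

theorem equivalent_pullback_green {P' : PolyEndo.{v₁, u₁}} {P : PolyEndo.{v₂, u₂}}
    (u : CartMor P' P) :
    HoSlice.Equivalent (green P') (HoSlice.pullback (forestMap u) (green P)) := by
  have h : Functor.IsEquivalence ((CategoricalPullback.CatCommSqOver.toFunctorToCategoricalPullback
    (forestMap u) (treeIncl P) (PTree P')).obj (greenSquare u)) := isHoPullback_greenSquare u
  exact ⟨((CategoricalPullback.CatCommSqOver.toFunctorToCategoricalPullback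
    (forestMap u) (treeIncl P) (PTree P')).obj (greenSquare u)).asEquivalence,
    -- The comparison functor followed by the first projection is the tree inclusion on the nose.
    ⟨Iso.refl (treeIncl P')⟩⟩

/-! ### Formal series -/

/-- `Nat.card` takes the value `0` on infinite types, so finiteness is what permits dividing by this
number. -/
theorem PiZero.autCard_ne_zero {C : Type u} [Groupoid.{v} C] (hC : ∀ X : C, Finite (Aut X))
    (T : PiZero C) : T.autCard ≠ 0 := by
  induction T using Quotient.inductionOn with
  | h X =>
    have := hC X
    exact (Nat.card_pos (α := Aut X)).ne'

theorem forestAutCard_single {C : Type u} [Groupoid.{v} C] (T : PiZero C) :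
    forestAutCard (Finsupp.single T 1) = T.autCard := by
  rw [forestAutCard, Finsupp.prod, Finsupp.support_single _ one_ne_zero]
  simp

theorem coeff_greenSeries_single {P : PolyEndo.{v, u}} (T : PiZero (PTree P)) :
    MvPowerSeries.coeff (Finsupp.single T 1) (greenSeries P) = (1 : ℚ) / T.autCard := by
  change greenSeries P (Finsupp.single T 1) = _
  simp [greenSeries]

theorem coeff_greenSeries_of_degree_ne_one {P : PolyEndo.{v, u}} {m : PiZero (PTree P) →₀ ℕ}
    (hm : m.degree ≠ 1) : MvPowerSeries.coeff m (greenSeries P) = 0 := by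
  change greenSeries P m = 0
  refine Finset.sum_eq_zero fun T _ => if_neg ?_
  rintro rfl
  exact hm (by simp)

theorem greenSeries_eq_pullbackSeries {P' : PolyEndo.{v₁, u₁}} {P : PolyEndo.{v₂, u₂}}
    (u : CartMor P' P) (hP : ∀ T : PTree P, Finite (Aut T)) :
    greenSeries P' = pullbackSeries u (greenSeries P) := by
  ext m
  change _ = MvPowerSeries.coeff (m.mapDomain (PiZero.map (treeMap u))) (greenSeries P) *
    forestAutCard (m.mapDomain (PiZero.map (treeMap u))) / forestAutCard m
  by_cases hm : m.degree = 1
  -- A monomial of degree one is a single variable, that is, a one-tree forest.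
  · obtain ⟨T, rfl⟩ := (Finsupp.sum_eq_one_iff m).mp hm
    have h : ((PiZero.map (treeMap u) T).autCard : ℚ) ≠ 0 :=
      Nat.cast_ne_zero.mpr (PiZero.autCard_ne_zero hP _)
    rw [Finsupp.mapDomain_single, coeff_greenSeries_single, coeff_greenSeries_single,
      forestAutCard_single, forestAutCard_single, one_div_mul_cancel h]
  -- `mapDomain` adds up multiplicities when several classes have the same image under `u`, so the
  -- degree, the number of trees in the forest, is unchanged.
  · rw [coeff_greenSeries_of_degree_ne_one hm, coeff_greenSeries_of_degree_ne_one, zero_mul,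
      zero_div]
    rwa [Finsupp.degree_mapDomain]

theorem mainTheorem5 (P' : PolyEndo.{v₁, u₁}) (P : PolyEndo.{v₂, u₂})
    (hP' : P'.IsFinitary) (hP : P.IsFinitary) (u : CartMor P' P) :
    HoSlice.Equivalent (green P') (HoSlice.pullback (forestMap u) (green P)) ∧
    IsHoPullback (greenSquare u) ∧
    ((∀ T : PTree P', Finite (Aut T)) → (∀ T : PTree P, Finite (Aut T)) →
      greenSeries P' = pullbackSeries u (greenSeries P)) := by
  exact ⟨equivalent_pullback_green u, isHoPullback_greenSquare u,
    fun _ h => greenSeries_eq_pullbackSeries u h⟩
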